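/- Theorem (Existence and uniqueness of the strong solution). Let $N\in\mathbb N$, $a_1,\dots,a_N\in\mathbb R$, and let $(W_{k,j})_{1\le j\le k\le N}$ be independent standard real Brownian motions on a probability space $(\Omega,\mathcal F,\mathbb P)$. Let $\xi=(\xi_{k,j})_{1\le j\le k\le N}$ be a real random vector independent of $W$; in particular, $\xi$ may be any deterministic vector. Consider on $[0,\infty)$ the Whittaker 2d growth system $$dT_{k,j}=dW_{k,j}+\Bigl(a_k+\mathbf 1_{\{j<k\}}\,e^{T_{k-1,j}-T_{k,j}}-\mathbf 1_{\{j>1\}}\,e^{T_{k,j}-T_{k-1,j-1}}\Bigr)dt,\qquad T_{k,j}(0)=\xi_{k,j},\qquad 1\le j\le k\le N .$$ A solution is a real process $T=(T_{k,j}(t))_{1\le j\le k\le N,\ t\ge 0}$ that almost surely has continuous paths, starts at $\xi$, and satisfies, for all $t\ge0$ and $1\le j\le k\le N$, $$T_{k,j}(t)=\xi_{k,j}+W_{k,j}(t)+\int_0^t\Bigl(a_k+\mathbf 1_{\{j<k\}}\,e^{T_{k-1,j}(s)-T_{k,j}(s)}-\mathbf 1_{\{j>1\}}\,e^{T_{k,j}(s)-T_{k-1,j-1}(s)}\Bigr)ds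 .$$ A strong solution is a solution adapted to the filtration generated by $\xi$, by $W$, and by the $\mathbb P$-null events. Then the system has a strong solution $T$ on $[0,\infty)$, and it is unique up to indistinguishability: every solution $T'$ with the same $W$ and $\xi$ (in particular every strong solution) satisfies $\mathbb P\bigl(T'_{k,j}(t)=T_{k,j}(t)\text{ for all }t\ge0,\ 1\le j\le k\le N\bigr)=1$. -/

import Mathlib

open MeasureTheory ProbabilityTheory
open scoped NNReal

noncomputable section

namespace Whittaker

/-- The triangular index set of the particles: pairs `(k, j)` with `1 ≤ j ≤ k ≤ N`. -/
abbrev Tri (N : ℕ) : Type :=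
  {p : ℕ × ℕ // 1 ≤ p.2 ∧ p.2 ≤ p.1 ∧ p.1 ≤ N}

/-- The drift of particle `(k, j)` at the configuration `x`,
`a_k + e^{x_{k-1,j} - x_{k,j}} - e^{x_{k,j} - x_{k-1,j-1}}`,
where the first exponential is absent if `j = k` (there is no particle `(k-1, k)`), and the second
one is absent if `j = 1` (there is no particle `(k-1, 0)`). -/
def drift {N : ℕ} (a : ℕ → ℝ) (x : Tri N → ℝ) (i : Tri N) : ℝ :=
  a i.1.1
    + (if h : i.1.2 < i.1.1 then
        Real.exp (x ⟨(i.1.1 - 1, i.1.2), by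
          obtain ⟨⟨k, j⟩, h1, h2, h3⟩ := i
          dsimp only at *
          omega⟩ - x i)
      else 0)
    - (if h : 1 < i.1.2 then
        Real.exp (x i - x ⟨(i.1.1 - 1, i.1.2 - 1), by
          obtain ⟨⟨k, j⟩, h1, h2, h3⟩ := i
          dsimp only at *
          omega⟩)
      else 0)

variable {Ω : Type*} {m : MeasurableSpace Ω}

/-- `W` is a family of independent standard real Brownian motions indexed by the particles. -/
structure IsBrownianFamily {N : ℕ} (W : Tri N → ℝ≥0 → Ω → ℝ) (P : Measure Ω) : Prop where
  measurable : ∀ i t, Measurable (W i t)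
  brownian : ∀ i, IsBrownianReal (W i) P
  indep : iIndepFun (fun i ω t ↦ W i t ω) P

/-- The filtration generated by the initial condition `ξ` and the driving processes `W`, augmented
by the null events: at time `t` it is generated by `ξ`, by `W i s` for all `i` and all `s ≤ t`, and
by the events of probability zero. For a deterministic `ξ` it is the augmented filtration
generated by `W`. -/
def drivingFiltration {N : ℕ} (W : Tri N → ℝ≥0 → Ω → ℝ) (ξ : Tri N → Ω → ℝ) (P : Measure Ω)
    (hW : ∀ i t, Measurable (W i t)) (hξ : ∀ i, Measurable (ξ i)) : Filtration ℝ≥0 m where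
  seq t := (⨆ i, MeasurableSpace.comap (ξ i) inferInstance)
    ⊔ (⨆ i, ⨆ s ≤ t, MeasurableSpace.comap (W i s) inferInstance)
    ⊔ MeasurableSpace.generateFrom {A | MeasurableSet[m] A ∧ P A = 0}
  mono' _ _ hst := sup_le_sup_right (sup_le_sup_left
    (iSup_mono fun _ ↦ biSup_mono fun _ h ↦ h.trans hst) _) _
  le' t := by
    refine sup_le (sup_le (iSup_le fun i ↦ (hξ i).comap_le) ?_) ?_
    · exact iSup_le fun i ↦ iSup₂_le fun s _ ↦ (hW i s).comap_le
    · exact MeasurableSpace.generateFrom_le fun A hA ↦ hA.1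

/-- `T` is a solution on `[0, ∞)`, with initial condition `ξ`, of the system
`dT_{k,j} = dW_{k,j} + (a_k + e^{T_{k-1,j} - T_{k,j}} - e^{T_{k,j} - T_{k-1,j-1}}) dt`:
almost surely, the paths are continuous and satisfy the integrated system at all times. (The
integrand is then continuous in time, so that the integral is a proper one.) -/
structure IsSolution {N : ℕ} (a : ℕ → ℝ) (W : Tri N → ℝ≥0 → Ω → ℝ) (ξ : Tri N → Ω → ℝ)
    (P : Measure Ω) (T : Tri N → ℝ≥0 → Ω → ℝ) : Prop where
  continuous : ∀ᵐ ω ∂P, ∀ i, Continuous (fun t ↦ T i t ω)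
  initial : ∀ᵐ ω ∂P, ∀ i, T i 0 ω = ξ i ω
  equation : ∀ᵐ ω ∂P, ∀ (i : Tri N) (t : ℝ≥0),
    T i t ω = ξ i ω + W i t ω
      + ∫ s in (0 : ℝ)..(t : ℝ), drift a (fun l ↦ T l s.toNNReal ω) i

/-- A strong solution: a solution, driven by the given Brownian motions `W` and started at the given
`ξ`, that is adapted to the augmented filtration generated by `ξ` and `W`. -/
structure IsStrongSolution {N : ℕ} (a : ℕ → ℝ) (W : Tri N → ℝ≥0 → Ω → ℝ) (ξ : Tri N → Ω → ℝ)
    (P : Measure Ω) (hW : ∀ i t, Measurable (W i t)) (hξ : ∀ i, Measurable (ξ i))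
    (T : Tri N → ℝ≥0 → Ω → ℝ) : Prop extends IsSolution a W ξ P T where
  adapted : ∀ i, Adapted (drivingFiltration W ξ P hW hξ) (T i)

end Whittaker

end

open Filter

namespace Whittaker

/-! The argument is pathwise and by induction on the level `k`, since the drift at level `k`
involves only levels `k - 1` and `k`, and particles within a level do not interact. Given level `k -
1`, write `T = V + X` with `V = ξ + W`. Then `X' = a + β e^{-X} - γ e^X` with known continuous `β, γ
≥ 0`. The substitution `X = a t + log p - log q` linearises this to `p' = b q`, `q' = c p`, where `b
= e^{-a t} β` and `c = e^{a t} γ`. Series of iterated integrals solve it globally, and `b, c ≥ 0`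
keeps `p, q` positive, so there is no explosion (`logRiccati_eq`). The formula uses the data up to
time `t` only, whence adaptedness (`measurable_solutionPath`). For uniqueness, once the lower levels
agree, the drift is nonincreasing in the particle's own position, so the squared difference of two
solutions cannot grow (`path_unique`). -/

/-! ### The linear system `p' = b q`, `q' = c p` -/

/-- The `n`-fold iterated integral with alternating weights `b, c, b, …`, as a function of the upper
limit. -/
noncomputable def iterInt (b c : ℝ≥0 → ℝ) : ℕ → ℝ≥0 → ℝ
  | 0, _ => 1
  | n + 1, t => ∫ s in (0 : ℝ)..t, b s.toNNReal * iterInt c b n s.toNNReal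

/-- The sum of the iterated integrals: the first component of the solution of
`p' = b q`, `q' = c p`, `p 0 = q 0 = 1`, the second one being `iterSum c b`. -/
noncomputable def iterSum (b c : ℝ≥0 → ℝ) (t : ℝ≥0) : ℝ := ∑' n, iterInt b c n t

lemma continuous_primitive {f : ℝ≥0 → ℝ} (hf : Continuous f) :
    Continuous fun t : ℝ≥0 ↦ ∫ s in (0 : ℝ)..t, f s.toNNReal :=
  (intervalIntegral.continuous_primitive (fun _ _ ↦
    (hf.comp continuous_real_toNNReal).intervalIntegrable _ _) 0).comp NNReal.continuous_coe

lemma hasDerivAt_primitive {f : ℝ≥0 → ℝ} (hf : Continuous f) (t : ℝ) :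
    HasDerivAt (fun t : ℝ ↦ ∫ s in (0 : ℝ)..t, f s.toNNReal) (f t.toNNReal) t :=
  (hf.comp continuous_real_toNNReal).integral_hasStrictDerivAt 0 t |>.hasDerivAt

lemma continuous_iterInt {b c : ℝ≥0 → ℝ} (hb : Continuous b) (hc : Continuous c) (n : ℕ) :
    Continuous (iterInt b c n) := by
  induction n generalizing b c with
  | zero => exact continuous_const
  | succ n ih => exact continuous_primitive (hb.mul (ih hc hb))

lemma iterInt_nonneg {b c : ℝ≥0 → ℝ} (hb : ∀ t, 0 ≤ b t) (hc : ∀ t, 0 ≤ c t) (n : ℕ) (t : ℝ≥0) :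
    0 ≤ iterInt b c n t := by
  induction n generalizing b c t with
  | zero => exact zero_le_one
  | succ n ih =>
    exact intervalIntegral.integral_nonneg t.coe_nonneg fun s _ ↦ mul_nonneg (hb _) (ih hc hb _)

/-- The weights swap at each integration, so one `M` must bound both. The factorial makes the series
converge locally uniformly. -/
lemma iterInt_le {b c : ℝ≥0 → ℝ} (hb : Continuous b) (hc : Continuous c) (hb0 : ∀ t, 0 ≤ b t)
    (hc0 : ∀ t, 0 ≤ c t) {R : ℝ≥0} {M : ℝ} (hbM : ∀ t ≤ R, b t ≤ M) (hcM : ∀ t ≤ R, c t ≤ M)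
    (n : ℕ) {t : ℝ≥0} (ht : t ≤ R) : iterInt b c n t ≤ (M * t) ^ n / n.factorial := by
  induction n generalizing b c t with
  | zero => simp [iterInt]
  | succ n ih =>
    have hM : 0 ≤ M := (hb0 t).trans (hbM t ht)
    calc iterInt b c (n + 1) t
        ≤ ∫ s in (0 : ℝ)..t, M * ((M * s) ^ n / n.factorial) := by
          refine intervalIntegral.integral_mono_on t.coe_nonneg ?_ ?_ fun s hs ↦ ?_
          · exact ((hb.mul (continuous_iterInt hc hb n)).comp
              continuous_real_toNNReal).intervalIntegrable _ _
          · exact (by fun_prop : Continuous fun s : ℝ ↦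
              M * ((M * s) ^ n / n.factorial)).intervalIntegrable _ _
          · have hsR : s.toNNReal ≤ R := (Real.toNNReal_le_iff_le_coe.2 hs.2).trans ht
            have h := ih hc hb hc0 hb0 hcM hbM hsR
            rw [Real.coe_toNNReal s hs.1] at h
            exact mul_le_mul (hbM _ hsR) h (iterInt_nonneg hc0 hb0 n _) hM
      _ = (M * t) ^ (n + 1) / (n + 1).factorial := by
          have h : ∀ s : ℝ, M * ((M * s) ^ n / n.factorial)
              = (M ^ (n + 1) / n.factorial) * s ^ n := fun s ↦ by rw [mul_pow]; ring
          simp_rw [h]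
          rw [intervalIntegral.integral_const_mul, integral_pow, Nat.factorial_succ]
          push_cast
          have : (n.factorial : ℝ) ≠ 0 := by positivity
          field_simp
          simp [mul_pow]

lemma exists_bound {b c : ℝ≥0 → ℝ} (hb : Continuous b) (hc : Continuous c) (R : ℝ≥0) :
    ∃ M, (∀ t ≤ R, b t ≤ M) ∧ ∀ t ≤ R, c t ≤ M := by
  obtain ⟨M, hM⟩ := (isCompact_Icc (a := (0 : ℝ≥0)) (b := R)).bddAbove_image
    (hb.sup hc).continuousOn
  refine ⟨M, fun t ht ↦ ?_, fun t ht ↦ ?_⟩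
  · exact le_sup_left.trans (hM ⟨t, ⟨zero_le, ht⟩, rfl⟩)
  · exact le_sup_right.trans (hM ⟨t, ⟨zero_le, ht⟩, rfl⟩)

lemma exists_summable_bound {b c : ℝ≥0 → ℝ} (hb : Continuous b) (hc : Continuous c)
    (hb0 : ∀ t, 0 ≤ b t) (hc0 : ∀ t, 0 ≤ c t) (R : ℝ≥0) :
    ∃ u : ℕ → ℝ, Summable u ∧ ∀ n, ∀ t ≤ R, ‖iterInt b c n t‖ ≤ u n := by
  obtain ⟨M, hbM, hcM⟩ := exists_bound hb hc R
  refine ⟨fun n ↦ (M * R) ^ n / n.factorial, Real.summable_pow_div_factorial _, fun n t ht ↦ ?_⟩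
  have hM : 0 ≤ M := (hb0 t).trans (hbM t ht)
  rw [Real.norm_of_nonneg (iterInt_nonneg hb0 hc0 n t)]
  refine (iterInt_le hb hc hb0 hc0 hbM hcM n ht).trans ?_
  have : (t : ℝ) ≤ R := ht
  dsimp only
  gcongr

section

variable {b c : ℝ≥0 → ℝ}

lemma summable_iterInt (hb : Continuous b) (hc : Continuous c) (hb0 : ∀ t, 0 ≤ b t)
    (hc0 : ∀ t, 0 ≤ c t) (t : ℝ≥0) : Summable fun n ↦ iterInt b c n t := by
  obtain ⟨u, hu, h⟩ := exists_summable_bound hb hc hb0 hc0 t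
  exact .of_norm_bounded hu fun n ↦ h n t le_rfl

lemma iterSum_pos (hb : Continuous b) (hc : Continuous c) (hb0 : ∀ t, 0 ≤ b t)
    (hc0 : ∀ t, 0 ≤ c t) (t : ℝ≥0) : 0 < iterSum b c t :=
  (summable_iterInt hb hc hb0 hc0 t).tsum_pos (iterInt_nonneg hb0 hc0 · t) 0 one_pos

lemma continuous_iterSum (hb : Continuous b) (hc : Continuous c) (hb0 : ∀ t, 0 ≤ b t)
    (hc0 : ∀ t, 0 ≤ c t) : Continuous (iterSum b c) := by
  refine continuous_iff_continuousAt.2 fun t ↦ ?_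
  obtain ⟨u, hu, h⟩ := exists_summable_bound hb hc hb0 hc0 (t + 1)
  exact (continuousOn_tsum (s := Set.Iic (t + 1)) (fun n ↦ (continuous_iterInt hb hc n).continuousOn)
    hu fun n s hs ↦ h n s hs).continuousAt (Iic_mem_nhds (lt_add_one t))

/-- Split off the term `n = 0` and integrate the rest termwise by dominated convergence. -/
lemma iterSum_eq (hb : Continuous b) (hc : Continuous c) (hb0 : ∀ t, 0 ≤ b t)
    (hc0 : ∀ t, 0 ≤ c t) (t : ℝ≥0) :
    iterSum b c t = 1 + ∫ s in (0 : ℝ)..t, b s.toNNReal * iterSum c b s.toNNReal := by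
  rw [iterSum, (summable_iterInt hb hc hb0 hc0 t).tsum_eq_zero_add]
  congr 1
  obtain ⟨u, hu, h⟩ := exists_summable_bound hc hb hc0 hb0 t
  obtain ⟨M, hbM, -⟩ := exists_bound hb hc t
  refine (intervalIntegral.hasSum_integral_of_dominated_convergence (fun n _ ↦ M * u n)
    (fun n ↦ ?_) (fun n ↦ ?_) ?_ ?_ ?_).tsum_eq
  · exact ((hb.mul (continuous_iterInt hc hb n)).comp
      continuous_real_toNNReal).aestronglyMeasurable
  · refine ae_of_all _ fun s hs ↦ ?_
    rw [Set.uIoc_of_le t.coe_nonneg] at hs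
    have hst : s.toNNReal ≤ t := Real.toNNReal_le_iff_le_coe.2 hs.2
    rw [norm_mul, Real.norm_of_nonneg (hb0 _)]
    exact mul_le_mul (hbM _ hst) (h n _ hst) (norm_nonneg _) ((hb0 _).trans (hbM _ hst))
  · exact ae_of_all _ fun _ _ ↦ hu.mul_left _
  · exact intervalIntegrable_const
  · exact ae_of_all _ fun s _ ↦ (summable_iterInt hc hb hc0 hb0 _).hasSum.mul_left _

lemma log_iterSum_eq (hb : Continuous b) (hc : Continuous c) (hb0 : ∀ t, 0 ≤ b t)
    (hc0 : ∀ t, 0 ≤ c t) (t : ℝ≥0) :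
    Real.log (iterSum b c t) = ∫ s in (0 : ℝ)..t,
      b s.toNNReal * iterSum c b s.toNNReal / iterSum b c s.toNNReal := by
  have hp := continuous_iterSum hb hc hb0 hc0
  have hq := continuous_iterSum hc hb hc0 hb0
  have hpos := iterSum_pos hb hc hb0 hc0
  -- A version of `p` on all of `ℝ`, so that a two-sided derivative exists at the endpoint `0` as
  -- well.
  set P : ℝ → ℝ := fun t ↦ 1 + ∫ s in (0 : ℝ)..t, b s.toNNReal * iterSum c b s.toNNReal
  have hP : ∀ s : ℝ, 0 ≤ s → P s = iterSum b c s.toNNReal := fun s hs ↦ by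
    rw [iterSum_eq hb hc hb0 hc0, Real.coe_toNNReal s hs]
  have hder (s : ℝ) (hs : s ∈ Set.uIcc (0 : ℝ) t) : HasDerivAt (fun s ↦ Real.log (P s))
      (b s.toNNReal * iterSum c b s.toNNReal / iterSum b c s.toNNReal) s := by
    rw [Set.uIcc_of_le t.coe_nonneg] at hs
    rw [← hP s hs.1]
    refine ((hasDerivAt_primitive (hb.mul hq) s).const_add 1).log ?_
    change P s ≠ 0
    rw [hP s hs.1]
    exact (hpos _).ne'
  rw [intervalIntegral.integral_eq_sub_of_hasDerivAt hder]
  · rw [hP _ t.coe_nonneg, hP 0 le_rfl, Real.toNNReal_coe, ← hP 0 le_rfl]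
    simp [P]
  · exact (((hb.mul hq).div hp fun s ↦ (hpos s).ne').comp
      continuous_real_toNNReal).intervalIntegrable _ _

end

/-! ### The scalar Riccati-type equation -/

/-- The solution of `x' = a + β e^{-x} - γ e^x`, `x 0 = 0`. -/
noncomputable def logRiccati (a : ℝ) (β γ : ℝ≥0 → ℝ) (t : ℝ≥0) : ℝ :=
  a * t
    + Real.log (iterSum (fun s ↦ Real.exp (-(a * s)) * β s) (fun s ↦ Real.exp (a * s) * γ s) t)
    - Real.log (iterSum (fun s ↦ Real.exp (a * s) * γ s) (fun s ↦ Real.exp (-(a * s)) * β s) t)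

section

variable {a : ℝ} {β γ : ℝ≥0 → ℝ}

lemma continuous_logRiccati (hβ : Continuous β) (hγ : Continuous γ) (hβ0 : ∀ t, 0 ≤ β t)
    (hγ0 : ∀ t, 0 ≤ γ t) : Continuous (logRiccati a β γ) := by
  have hb : Continuous fun s : ℝ≥0 ↦ Real.exp (-(a * s)) * β s := by fun_prop
  have hc : Continuous fun s : ℝ≥0 ↦ Real.exp (a * s) * γ s := by fun_prop
  have hb0 (s : ℝ≥0) : 0 ≤ Real.exp (-(a * s)) * β s := mul_nonneg (Real.exp_pos _).le (hβ0 s)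
  have hc0 (s : ℝ≥0) : 0 ≤ Real.exp (a * s) * γ s := mul_nonneg (Real.exp_pos _).le (hγ0 s)
  have h1 := (continuous_iterSum hb hc hb0 hc0).log fun s ↦ (iterSum_pos hb hc hb0 hc0 s).ne'
  have h2 := (continuous_iterSum hc hb hc0 hb0).log fun s ↦ (iterSum_pos hc hb hc0 hb0 s).ne'
  exact ((by fun_prop : Continuous fun s : ℝ≥0 ↦ a * (s : ℝ)).add h1).sub h2

/-- With `p`, `q` the two series, `e^{-X} = e^{-a t} q / p`, so the exponential terms are exactly
the logarithmic derivatives of `p` and `q`. -/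
lemma logRiccati_eq (hβ : Continuous β) (hγ : Continuous γ) (hβ0 : ∀ t, 0 ≤ β t)
    (hγ0 : ∀ t, 0 ≤ γ t) (t : ℝ≥0) :
    logRiccati a β γ t = ∫ s in (0 : ℝ)..t, (a
      + β s.toNNReal * Real.exp (-logRiccati a β γ s.toNNReal)
      - γ s.toNNReal * Real.exp (logRiccati a β γ s.toNNReal)) := by
  set b : ℝ≥0 → ℝ := fun s ↦ Real.exp (-(a * s)) * β s with hb_def
  set c : ℝ≥0 → ℝ := fun s ↦ Real.exp (a * s) * γ s with hc_def
  have hb : Continuous b := by fun_prop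
  have hc : Continuous c := by fun_prop
  have hb0 (s : ℝ≥0) : 0 ≤ b s := mul_nonneg (Real.exp_pos _).le (hβ0 s)
  have hc0 (s : ℝ≥0) : 0 ≤ c s := mul_nonneg (Real.exp_pos _).le (hγ0 s)
  have hp := iterSum_pos hb hc hb0 hc0
  have hq := iterSum_pos hc hb hc0 hb0
  have hX (s : ℝ≥0) : logRiccati a β γ s
      = a * s + Real.log (iterSum b c s) - Real.log (iterSum c b s) := rfl
  have h1 (s : ℝ≥0) : β s * Real.exp (-logRiccati a β γ s)
      = b s * iterSum c b s / iterSum b c s := by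
    rw [hX, neg_sub, ← sub_sub, Real.exp_sub, Real.exp_sub, Real.exp_log (hp s),
      Real.exp_log (hq s), hb_def]
    simp only [Real.exp_neg]
    ring
  have h2 (s : ℝ≥0) : γ s * Real.exp (logRiccati a β γ s)
      = c s * iterSum b c s / iterSum c b s := by
    rw [hX, Real.exp_sub, Real.exp_add, Real.exp_log (hp s), Real.exp_log (hq s), hc_def]
    ring
  simp_rw [h1, h2]
  have cp := continuous_iterSum hb hc hb0 hc0
  have cq := continuous_iterSum hc hb hc0 hb0
  have i1 : IntervalIntegrable (fun s : ℝ ↦ b s.toNNReal * iterSum c b s.toNNReal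
      / iterSum b c s.toNNReal) volume 0 t :=
    (((hb.mul cq).div cp fun s ↦ (hp s).ne').comp continuous_real_toNNReal).intervalIntegrable _ _
  have i2 : IntervalIntegrable (fun s : ℝ ↦ c s.toNNReal * iterSum b c s.toNNReal
      / iterSum c b s.toNNReal) volume 0 t :=
    (((hc.mul cp).div cq fun s ↦ (hq s).ne').comp continuous_real_toNNReal).intervalIntegrable _ _
  rw [intervalIntegral.integral_sub (intervalIntegrable_const.add i1) i2,
    intervalIntegral.integral_add intervalIntegrable_const i1, hX,
    log_iterSum_eq hb hc hb0 hc0, log_iterSum_eq hc hb hc0 hb0]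
  simp [mul_comm]

end

/-! ### Pathwise construction, level by level -/

/-- The solution of the system with driving paths `V`, on the extended index set `ℕ × ℕ`. -/
noncomputable def solutionPath (a : ℕ → ℝ) (V : ℕ → ℕ → ℝ≥0 → ℝ) : ℕ → ℕ → ℝ≥0 → ℝ
  -- A dummy level: for the particle `(1, 1)` both indicators vanish, so this value never enters.
  | 0, _, _ => 0
  | k + 1, j, t => V (k + 1) j t + logRiccati (a (k + 1))
      (fun s ↦ if j < k + 1 then Real.exp (solutionPath a V k j s - V (k + 1) j s) else 0)
      (fun s ↦ if 1 < j then Real.exp (V (k + 1) j s - solutionPath a V k (j - 1) s) else 0) t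

section

variable {a : ℕ → ℝ} {V : ℕ → ℕ → ℝ≥0 → ℝ}

lemma continuous_ite_exp {p : Prop} [Decidable p] {f : ℝ≥0 → ℝ} (hf : Continuous f) :
    Continuous fun s ↦ if p then Real.exp (f s) else 0 := by
  split_ifs <;> fun_prop

lemma ite_exp_nonneg {p : Prop} [Decidable p] (x : ℝ) : 0 ≤ if p then Real.exp x else 0 := by
  split_ifs <;> positivity

lemma continuous_solutionPath (hV : ∀ k j, Continuous (V k j)) (k j : ℕ) :
    Continuous (solutionPath a V k j) := by
  induction k generalizing j with
  | zero => exact continuous_const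
  | succ k ih =>
    exact (hV _ _).add (continuous_logRiccati (continuous_ite_exp ((ih j).sub (hV _ _)))
      (continuous_ite_exp ((hV _ _).sub (ih _))) (fun _ ↦ ite_exp_nonneg _)
      fun _ ↦ ite_exp_nonneg _)

lemma solutionPath_eq (hV : ∀ k j, Continuous (V k j)) (k j : ℕ) (t : ℝ≥0) :
    solutionPath a V (k + 1) j t = V (k + 1) j t + ∫ s in (0 : ℝ)..t, (a (k + 1)
      + (if j < k + 1 then Real.exp (solutionPath a V k j s.toNNReal
          - solutionPath a V (k + 1) j s.toNNReal) else 0)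
      - (if 1 < j then Real.exp (solutionPath a V (k + 1) j s.toNNReal
          - solutionPath a V k (j - 1) s.toNNReal) else 0)) := by
  have hs := continuous_solutionPath (a := a) hV
  conv_lhs => rw [solutionPath]
  have hβ : Continuous fun s ↦ if j < k + 1 then
      Real.exp (solutionPath a V k j s - V (k + 1) j s) else 0 :=
    continuous_ite_exp ((hs k j).sub (hV _ _))
  have hγ : Continuous fun s ↦ if 1 < j then
      Real.exp (V (k + 1) j s - solutionPath a V k (j - 1) s) else 0 :=
    continuous_ite_exp ((hV _ _).sub (hs _ _))
  rw [logRiccati_eq hβ hγ (fun _ ↦ ite_exp_nonneg _) fun _ ↦ ite_exp_nonneg _]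
  congr 1
  refine intervalIntegral.integral_congr fun s _ ↦ ?_
  rw [solutionPath]
  generalize logRiccati _ _ _ _ = x
  congr 2
  · split_ifs
    · rw [← Real.exp_add]; congr 1; ring
    · exact zero_mul _
  · split_ifs
    · rw [← Real.exp_add]; congr 1; ring
    · exact zero_mul _

end

/-! ### Measurability in `ω` -/

section

variable {Ω : Type*}

lemma measurable_primitive {mΩ : MeasurableSpace Ω} {f : ℝ≥0 → Ω → ℝ} {t : ℝ≥0}
    (hf : ∀ ω, Continuous (f · ω)) (hm : ∀ s ≤ t, Measurable (f s)) :
    Measurable fun ω ↦ ∫ s in (0 : ℝ)..t, f s.toNNReal ω := by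
  -- Freezing time at `t` keeps the integrand on `[0, t]` and gives joint measurability from data up
  -- to `t` alone.
  have h : Measurable (Function.uncurry fun (s : ℝ≥0) ω ↦ f (min s t) ω) :=
    measurable_uncurry_of_continuous_of_measurable
      (fun ω ↦ (hf ω).comp (continuous_id.min continuous_const)) fun s ↦ hm _ (min_le_right _ _)
  have h' : Measurable fun p : Ω × ℝ ↦ f (min p.2.toNNReal t) p.1 :=
    h.comp (measurable_snd.real_toNNReal.prodMk measurable_fst)
  have : (fun ω ↦ ∫ s in (0 : ℝ)..t, f s.toNNReal ω)
      = fun ω ↦ ∫ s in Set.Ioc (0 : ℝ) t, f (min s.toNNReal t) ω := by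
    ext ω
    rw [intervalIntegral.integral_of_le t.coe_nonneg]
    refine setIntegral_congr_fun measurableSet_Ioc fun s hs ↦ ?_
    simp only [min_eq_left (Real.toNNReal_le_iff_le_coe.2 hs.2)]
  rw [this]
  exact h'.stronglyMeasurable.integral_prod_right'.measurable

lemma measurable_iterSum {mΩ : MeasurableSpace Ω} {b c : ℝ≥0 → Ω → ℝ} {t : ℝ≥0}
    (hb : ∀ ω, Continuous (b · ω)) (hc : ∀ ω, Continuous (c · ω))
    (hb0 : ∀ ω s, 0 ≤ b s ω) (hc0 : ∀ ω s, 0 ≤ c s ω)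
    (hbm : ∀ s ≤ t, Measurable (b s)) (hcm : ∀ s ≤ t, Measurable (c s)) :
    Measurable fun ω ↦ iterSum (b · ω) (c · ω) t := by
  have h (n : ℕ) : Measurable fun ω ↦ iterInt (b · ω) (c · ω) n t := by
    induction n generalizing b c t with
    | zero => exact measurable_const
    | succ n ih =>
      exact measurable_primitive (f := fun s ω ↦ b s ω * iterInt (c · ω) (b · ω) n s)
        (fun ω ↦ (hb ω).mul (continuous_iterInt (hc ω) (hb ω) n)) fun s hs ↦
        (hbm s hs).mul (ih hc hb hc0 hb0 (fun r hr ↦ hcm r (hr.trans hs))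
          fun r hr ↦ hbm r (hr.trans hs))
  exact measurable_of_tendsto_metrizable (fun n ↦ Finset.measurable_fun_sum (Finset.range n)
    fun i _ ↦ h i) (tendsto_pi_nhds.2 fun ω ↦
    (summable_iterInt (hb ω) (hc ω) (hb0 ω) (hc0 ω) t).hasSum.tendsto_sum_nat)

lemma measurable_logRiccati {mΩ : MeasurableSpace Ω} {a : ℝ} {β γ : ℝ≥0 → Ω → ℝ} {t : ℝ≥0}
    (hβ : ∀ ω, Continuous (β · ω)) (hγ : ∀ ω, Continuous (γ · ω))
    (hβ0 : ∀ ω s, 0 ≤ β s ω) (hγ0 : ∀ ω s, 0 ≤ γ s ω)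
    (hβm : ∀ s ≤ t, Measurable (β s)) (hγm : ∀ s ≤ t, Measurable (γ s)) :
    Measurable fun ω ↦ logRiccati a (β · ω) (γ · ω) t := by
  have hb ω : Continuous fun s : ℝ≥0 ↦ Real.exp (-(a * s)) * β s ω :=
    (by fun_prop : Continuous fun s : ℝ≥0 ↦ Real.exp (-(a * s))).mul (hβ ω)
  have hc ω : Continuous fun s : ℝ≥0 ↦ Real.exp (a * s) * γ s ω :=
    (by fun_prop : Continuous fun s : ℝ≥0 ↦ Real.exp (a * s)).mul (hγ ω)
  have hb0 ω (s : ℝ≥0) : 0 ≤ Real.exp (-(a * s)) * β s ω :=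
    mul_nonneg (Real.exp_pos _).le (hβ0 ω s)
  have hc0 ω (s : ℝ≥0) : 0 ≤ Real.exp (a * s) * γ s ω :=
    mul_nonneg (Real.exp_pos _).le (hγ0 ω s)
  have hbm (s : ℝ≥0) (hs : s ≤ t) : Measurable fun ω ↦ Real.exp (-(a * s)) * β s ω :=
    (hβm s hs).const_mul _
  have hcm (s : ℝ≥0) (hs : s ≤ t) : Measurable fun ω ↦ Real.exp (a * s) * γ s ω :=
    (hγm s hs).const_mul _
  exact (measurable_const.add (measurable_iterSum hb hc hb0 hc0 hbm hcm).log).sub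
    (measurable_iterSum hc hb hc0 hb0 hcm hbm).log

/-- The σ-algebra is arbitrary and only times `s ≤ t` are assumed measurable: taking the
filtration's σ-algebra at time `t` gives adaptedness. -/
lemma measurable_solutionPath {mΩ : MeasurableSpace Ω} {a : ℕ → ℝ} {V : ℕ → ℕ → ℝ≥0 → Ω → ℝ}
    {t : ℝ≥0} (hV : ∀ k j ω, Continuous (V k j · ω)) (hm : ∀ k j, ∀ s ≤ t, Measurable (V k j s))
    (k j : ℕ) : Measurable fun ω ↦ solutionPath a (fun k j s ↦ V k j s ω) k j t := by
  induction k generalizing j t with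
  | zero => exact measurable_const
  | succ k ih =>
    have hs k j ω := continuous_solutionPath (a := a) (V := fun k j s ↦ V k j s ω)
      (fun k j ↦ hV k j ω) k j
    have ih' (j : ℕ) (s : ℝ≥0) (hst : s ≤ t) := ih (fun k j r hr ↦ hm k j r (hr.trans hst)) j
    refine (hm _ _ t le_rfl).add (measurable_logRiccati
      (β := fun s ω ↦ if j < k + 1 then
        Real.exp (solutionPath a (fun k j s ↦ V k j s ω) k j s - V (k + 1) j s ω) else 0)
      (γ := fun s ω ↦ if 1 < j then
        Real.exp (V (k + 1) j s ω - solutionPath a (fun k j s ↦ V k j s ω) k (j - 1) s) else 0)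
      (fun ω ↦ continuous_ite_exp ((hs _ _ ω).sub (hV _ _ ω)))
      (fun ω ↦ continuous_ite_exp ((hV _ _ ω).sub (hs _ _ ω)))
      (fun _ _ ↦ ite_exp_nonneg _) (fun _ _ ↦ ite_exp_nonneg _)
      (fun s hst ↦ ?_) fun s hst ↦ ?_)
    · split_ifs
      · exact ((ih' _ s hst).sub (hm _ _ s hst)).exp
      · exact measurable_const
    · split_ifs
      · exact ((hm _ _ s hst).sub (ih' _ s hst)).exp
      · exact measurable_const

end

/-! ### Uniqueness by monotonicity of the drift -/

/-- Two solutions of an integral equation with drifts in opposite order to the solutions agree. -/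
lemma eq_of_dissipative {x y f g : ℝ≥0 → ℝ} (v : ℝ≥0 → ℝ) (hf : Continuous f) (hg : Continuous g)
    (hx : ∀ t, x t = v t + ∫ s in (0 : ℝ)..t, f s.toNNReal)
    (hy : ∀ t, y t = v t + ∫ s in (0 : ℝ)..t, g s.toNNReal)
    (h : ∀ t, (x t - y t) * (f t - g t) ≤ 0) (t : ℝ≥0) : x t = y t := by
  set D : ℝ → ℝ := fun t ↦ ∫ s in (0 : ℝ)..t, (f s.toNNReal - g s.toNNReal) with hD_def
  have hD (s : ℝ) (hs : 0 ≤ s) : D s = x s.toNNReal - y s.toNNReal := by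
    rw [hx, hy, Real.coe_toNNReal s hs, hD_def]
    simp only
    have hfi : IntervalIntegrable (fun r : ℝ ↦ f r.toNNReal) volume 0 s :=
      (hf.comp continuous_real_toNNReal).intervalIntegrable _ _
    have hgi : IntervalIntegrable (fun r : ℝ ↦ g r.toNNReal) volume 0 s :=
      (hg.comp continuous_real_toNNReal).intervalIntegrable _ _
    rw [intervalIntegral.integral_sub hfi hgi]
    ring
  -- The driving term `v` cancels in `x - y`, so the difference is differentiable even though `x`
  -- and `y` need not be.
  have hder (s : ℝ) : HasDerivAt (fun s ↦ D s ^ 2)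
      (2 * D s * (f s.toNNReal - g s.toNNReal)) s := by
    refine ((hasDerivAt_primitive (hf.sub hg) s).fun_pow 2).congr_deriv ?_
    simp [D]
  have hanti : AntitoneOn (fun s ↦ D s ^ 2) (Set.Ici 0) := by
    refine antitoneOn_of_deriv_nonpos (convex_Ici 0)
      (fun s _ ↦ (hder s).continuousAt.continuousWithinAt)
      (fun s _ ↦ (hder s).differentiableAt.differentiableWithinAt) fun s hs ↦ ?_
    rw [interior_Ici] at hs
    rw [(hder s).deriv, hD s hs.le, mul_assoc]
    linarith [h s.toNNReal]
  have h0 : D t ^ 2 ≤ D 0 ^ 2 := hanti Set.self_mem_Ici t.coe_nonneg t.coe_nonneg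
  have hD0 : D 0 = 0 := by simp [hD_def]
  have := hD t t.coe_nonneg
  rw [Real.toNNReal_coe] at this
  have : D t = 0 := by
    rw [hD0] at h0
    exact pow_eq_zero_iff two_ne_zero |>.1 (le_antisymm (by simpa using h0) (sq_nonneg _))
  linarith

section

variable {N : ℕ} {a : ℕ → ℝ}

lemma continuous_drift {x : Tri N → ℝ≥0 → ℝ} (hx : ∀ i, Continuous (x i)) (i : Tri N) :
    Continuous fun t ↦ drift a (fun l ↦ x l t) i := by
  unfold drift
  split_ifs <;> fun_prop

/-- The drift of a particle is nonincreasing in its own position. -/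
lemma sub_mul_drift_sub_nonpos {x y : Tri N → ℝ} {i : Tri N}
    (h : ∀ l : Tri N, l.1.1 < i.1.1 → x l = y l) :
    (x i - y i) * (drift a x i - drift a y i) ≤ 0 := by
  obtain ⟨⟨k, j⟩, h1, h2, h3⟩ := i
  dsimp only at h1 h2 h3 h
  unfold drift
  dsimp only
  rcases le_total (x ⟨(k, j), h1, h2, h3⟩) (y ⟨(k, j), h1, h2, h3⟩) with hle | hle
  · refine mul_nonpos_of_nonpos_of_nonneg (sub_nonpos.2 hle) (sub_nonneg.2 ?_)
    refine sub_le_sub (add_le_add_right ?_ _) ?_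
    · split_ifs
      · rw [h ⟨(k - 1, j), _⟩ (by dsimp only; omega)]; gcongr
      · rfl
    · split_ifs
      · rw [h ⟨(k - 1, j - 1), _⟩ (by dsimp only; omega)]; gcongr
      · rfl
  · refine mul_nonpos_of_nonneg_of_nonpos (sub_nonneg.2 hle) (sub_nonpos.2 ?_)
    refine sub_le_sub (add_le_add_right ?_ _) ?_
    · split_ifs
      · rw [h ⟨(k - 1, j), _⟩ (by dsimp only; omega)]; gcongr
      · rfl
    · split_ifs
      · rw [h ⟨(k - 1, j - 1), _⟩ (by dsimp only; omega)]; gcongr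
      · rfl

lemma path_unique {x y v : Tri N → ℝ≥0 → ℝ} (hx : ∀ i, Continuous (x i))
    (hy : ∀ i, Continuous (y i))
    (hxe : ∀ i (t : ℝ≥0), x i t = v i t
      + ∫ s in (0 : ℝ)..t, drift a (fun l ↦ x l s.toNNReal) i)
    (hye : ∀ i (t : ℝ≥0), y i t = v i t
      + ∫ s in (0 : ℝ)..t, drift a (fun l ↦ y l s.toNNReal) i) (i : Tri N) (t : ℝ≥0) :
    x i t = y i t := by
  induction hk : i.1.1 using Nat.strong_induction_on generalizing i t with
  | _ k ih =>
    subst hk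
    exact eq_of_dissipative (v i) (continuous_drift hx i) (continuous_drift hy i) (hxe i) (hye i)
      (fun s ↦ sub_mul_drift_sub_nonpos (x := fun l ↦ x l s) (y := fun l ↦ y l s)
        fun l hl ↦ ih _ hl l s rfl) t

/-! ### Back to the triangular index set -/

/-- A family indexed by the particles, extended by zero. -/
def extendZero {α : Type*} (v : Tri N → α → ℝ) (k j : ℕ) (t : α) : ℝ :=
  if h : 1 ≤ j ∧ j ≤ k ∧ k ≤ N then v ⟨(k, j), h⟩ t else 0

lemma solutionPath_extendZero_eq {v : Tri N → ℝ≥0 → ℝ} (hv : ∀ i, Continuous (v i)) (i : Tri N)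
    (t : ℝ≥0) :
    solutionPath a (extendZero v) i.1.1 i.1.2 t = v i t + ∫ s in (0 : ℝ)..t,
      drift a (fun l : Tri N ↦ solutionPath a (extendZero v) l.1.1 l.1.2 s.toNNReal) i := by
  obtain ⟨⟨k, j⟩, h1, h2, h3⟩ := i
  dsimp only at h1 h2 h3 ⊢
  obtain ⟨k, rfl⟩ : ∃ l, k = l + 1 := ⟨k - 1, by omega⟩
  have hV (k j : ℕ) : Continuous (extendZero v k j) := by
    unfold extendZero
    split_ifs
    · exact hv _
    · exact continuous_const
  rw [solutionPath_eq hV]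
  simp [drift, extendZero, h1, h2, h3]

end

end Whittaker

/-! ### Strong existence and uniqueness -/

theorem mainTheorem2 {Ω : Type*} {m : MeasurableSpace Ω} (P : Measure Ω) [IsProbabilityMeasure P]
    (N : ℕ) (a : ℕ → ℝ)
    (W : Whittaker.Tri N → ℝ≥0 → Ω → ℝ) (hW : Whittaker.IsBrownianFamily W P)
    (ξ : Whittaker.Tri N → Ω → ℝ) (hξ : ∀ i, Measurable (ξ i))
    (hind : IndepFun (fun ω i ↦ ξ i ω) (fun ω i t ↦ W i t ω) P) :
    ∃ T : Whittaker.Tri N → ℝ≥0 → Ω → ℝ,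
      Whittaker.IsStrongSolution a W ξ P hW.measurable hξ T ∧
      ∀ T' : Whittaker.Tri N → ℝ≥0 → Ω → ℝ, Whittaker.IsSolution a W ξ P T' →
        ∀ᵐ ω ∂P, ∀ (i : Whittaker.Tri N) (t : ℝ≥0), T' i t ω = T i t ω := by
  have hae : ∀ᵐ ω ∂P, ∀ i, Continuous (W i · ω) :=
    ae_all_iff.2 fun i ↦ (hW.brownian i).cont
  have hae0 : ∀ᵐ ω ∂P, ∀ i, W i 0 ω = 0 :=
    ae_all_iff.2 fun i ↦ (hW.brownian i).toIsPreBrownianReal.eval_zero_ae_eq_zero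
  -- The set of discontinuous paths need not be measurable; its measurable hull is still null.
  set A : Set Ω := (toMeasurable P {ω | ¬ ∀ i, Continuous (W i · ω)})ᶜ
  have hAm : MeasurableSet A := (measurableSet_toMeasurable _ _).compl
  have hA0 : P Aᶜ = 0 := by
    rw [compl_compl, measure_toMeasurable]
    exact hae
  have hA : ∀ᵐ ω ∂P, ω ∈ A := hA0
  have hAc (ω : Ω) (hω : ω ∈ A) (i) : Continuous (W i · ω) := by
    by_contra h
    exact hω (subset_toMeasurable _ _ fun h' ↦ h (h' i))
  -- Replacing `W` by `0` off `A` makes every path continuous, as the measurability lemmas require.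
  set v : Whittaker.Tri N → ℝ≥0 → Ω → ℝ := fun i t ω ↦ ξ i ω + A.indicator (W i t) ω
  have hvc (i) (ω : Ω) : Continuous (v i · ω) := by
    refine continuous_const.add ?_
    by_cases hω : ω ∈ A
    · simpa [hω] using hAc ω hω i
    · simpa [hω] using continuous_const
  set T : Whittaker.Tri N → ℝ≥0 → Ω → ℝ := fun i t ω ↦
    Whittaker.solutionPath a (Whittaker.extendZero fun i t ↦ v i t ω) i.1.1 i.1.2 t
  have hVc (k j : ℕ) (ω : Ω) : Continuous (Whittaker.extendZero (fun i t ↦ v i t ω) k j) := by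
    unfold Whittaker.extendZero
    split_ifs
    · exact hvc _ ω
    · exact continuous_const
  have hTc (ω : Ω) (i) : Continuous (T i · ω) :=
    Whittaker.continuous_solutionPath (fun k j ↦ hVc k j ω) _ _
  have hTe (ω : Ω) (hω : ω ∈ A) (i) (t : ℝ≥0) : T i t ω = ξ i ω + W i t ω
      + ∫ s in (0 : ℝ)..t, Whittaker.drift a (fun l ↦ T l s.toNNReal ω) i := by
    have := Whittaker.solutionPath_extendZero_eq (a := a) (v := fun i t ↦ v i t ω)
      (fun i ↦ hvc i ω) i t
    rw [show ξ i ω + W i t ω = v i t ω by simp [v, hω]]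
    exact this
  refine ⟨T, ⟨⟨ae_of_all _ hTc, ?_, ?_⟩, fun i t ↦ ?_⟩, fun T' hT' ↦ ?_⟩
  · filter_upwards [hA, hae0] with ω hω h0 i
    rw [hTe ω hω, h0]
    simp
  · filter_upwards [hA] with ω hω using hTe ω hω
  · set F := Whittaker.drivingFiltration W ξ P hW.measurable hξ
    have hξF (i) (s : ℝ≥0) : Measurable[F s] (ξ i) :=
      Measurable.of_comap_le (le_sup_of_le_left (le_sup_of_le_left (le_iSup_iff.2 fun _ h ↦ h i)))
    have hWF (i) (s : ℝ≥0) : Measurable[F s] (W i s) :=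
      Measurable.of_comap_le (le_sup_of_le_left (le_sup_of_le_right
        (le_iSup_of_le i (le_iSup₂_of_le s le_rfl le_rfl))))
    -- Here the augmentation matters: `Aᶜ` is a null event, so it belongs to the filtration at every
    -- time.
    have hAF (s : ℝ≥0) : MeasurableSet[F s] A := by
      refine MeasurableSet.of_compl ?_
      exact (le_sup_right : _ ≤ F s) _ (MeasurableSpace.measurableSet_generateFrom
        ⟨hAm.compl, hA0⟩)
    have hvF (i) (s : ℝ≥0) (hs : s ≤ t) : Measurable[F t] (v i s) :=
      ((hξF i s).add ((hWF i s).indicator (hAF s))).mono (F.mono hs) le_rfl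
    refine Whittaker.measurable_solutionPath (mΩ := F t)
      (V := fun k j s ω ↦ Whittaker.extendZero (fun i t ↦ v i t ω) k j s) hVc
      (fun k j s hs ↦ ?_) _ _
    unfold Whittaker.extendZero
    split_ifs
    · exact hvF _ s hs
    · exact measurable_const
  · filter_upwards [hA, hT'.continuous, hT'.equation] with ω hω hc he
    exact Whittaker.path_unique (v := fun i t ↦ ξ i ω + W i t ω) hc (hTc ω) he (hTe ω hω)
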